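/- Let $n \ge 3$ and consider simple undirected graphs on the vertex (player) set $V_n = \{1,\dots,n\}$. For a graph $G$ and $u,v \in V_n$, let the relevance $\mathrm{rel}_G(u,v)$ be the number of vertices $w \neq v$ such that every $v$-$w$ path in $G$ visits $u$. Under the uniform vertex destroyer, which destroys each vertex with probability $1/n$ in every graph, the cost of player $v$ is $$\mathrm{cost}_G(v) = \frac1n \sum_{u \in V_n} \mathrm{rel}_G(u,v) \quad\text{if } G \text{ is connected},$$ and $\mathrm{cost}_G(v) = \infty$ if $G$ is disconnected. The graph $G$ is a swap equilibrium (SE) if no player can lower her cost by removing one incident edge or by replacing one incident edge by a new incident one; that is, $\mathrm{cost}_G(a) \le \mathrm{cost}_{G-ab}(a)$ for every edge $ab$ of $G$, and $\mathrm{cost}_G(a) \le \mathrm{cost}_{G-ab+ac}(a)$ for every edge $ab$ and every non-edge $ac$ ($c \ne a$) of $G$. Theorem. Let $G$ be a connected graph on $V_n$ that is a swap equilibrium under the uniform vertex destroyer. Then $G$ is two-connected (that is, it has only one block, a block being a maximal connected subgraph without a cutvertex of its own) or $G$ does not contain any cycle and thus is a tree. -/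

import Mathlib

open scoped ENNReal

namespace SwapGame

noncomputable section

variable {V : Type*}

/-- Remove the edge `ab` from `G`. -/
def removeEdge (G : SimpleGraph V) (a b : V) : SimpleGraph V :=
  G.deleteEdges {s(a, b)}

/-- `(a, b, c)` is a swap for `G`: `ab` is an edge, and `ac` is a non-edge
(between two different players, since graphs are simple). -/
def IsSwap (G : SimpleGraph V) (a b c : V) : Prop :=
  G.Adj a b ∧ c ≠ a ∧ ¬ G.Adj a c

/-- The graph `G + (a, b, c)`: remove the edge `ab` and insert the edge `ac`. -/
def swap (G : SimpleGraph V) (a b c : V) : SimpleGraph V :=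
  removeEdge G a b ⊔ SimpleGraph.edge a c

/-- The relevance of `u` for `v`: the number of vertices `w` other than `v` such that every
`v`-`w` path visits `u`, that is, the number of vertices that `v` is cut off from when all edges
at `u` are removed. In a connected graph on `n` vertices, `v` has relevance `n - 1` for itself. -/
def rel (G : SimpleGraph V) (u v : V) : ℕ :=
  {w : V | w ≠ v ∧ ∀ P : G.Path v w, u ∈ P.1.support}.ncard

/-- A vertex destroyer associates a probability measure on the vertices with each graph. -/
abbrev VertexDestroyer (V : Type*) := SimpleGraph V → PMF V

/-- The uniform vertex destroyer picks each vertex of each graph with probability `1 / n`. -/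
def VertexDestroyer.IsUniform [Fintype V] (D : VertexDestroyer V) : Prop :=
  ∀ (G : SimpleGraph V) (u : V), D G u = (Fintype.card V : ℝ≥0∞)⁻¹

open Classical in
/-- The cost of player `v` in `G`: the expected number of vertices `v` will be cut off from;
it is infinite when `G` is disconnected. -/
def cost [Fintype V] (D : VertexDestroyer V) (G : SimpleGraph V) (v : V) : ℝ≥0∞ :=
  if G.Connected then ∑ u : V, (rel G u v : ℝ≥0∞) * D G u else ∞

/-- `G` is a swap equilibrium: no player improves by swapping or by removing an incident edge. -/
def IsSwapEquilibrium [Fintype V] (D : VertexDestroyer V) (G : SimpleGraph V) : Prop :=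
  (∀ a b c : V, IsSwap G a b c → cost D G a ≤ cost D (swap G a b c) a) ∧
  (∀ a b : V, G.Adj a b → cost D G a ≤ cost D (removeEdge G a b) a)

/-- Two-connectedness: at least three vertices, connected, and still connected after the removal
of any one vertex. -/
def IsTwoConnected [Fintype V] (G : SimpleGraph V) : Prop :=
  3 ≤ Fintype.card V ∧ G.Connected ∧ ∀ v : V, (G.induce {v}ᶜ).Connected

/-- `G[B]` is connected and has no cutvertex. -/
def IsNonseparable (G : SimpleGraph V) (B : Set V) : Prop :=
  (G.induce B).Connected ∧ ∀ v ∈ B, (G.induce (B \ {v})).Preconnected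

/-- A block of `G`, given by its vertex set: an inclusion-maximal set `B` for which `G[B]` is
connected and has no cutvertex. -/
def IsBlock (G : SimpleGraph V) (B : Set V) : Prop :=
  Maximal (IsNonseparable G) B

end

end SwapGame

namespace SwapGame

section

variable {V : Type*} {G H : SimpleGraph V} {u x y z : V}

/-! A connected graph that is no tree has a non-bridge edge `av`. Suppose `v` separates `a` from
another neighbor `c` of `v`. Then `a` gains by swapping `av` for `ac`: the detour `a`-`c`-`v`, or a
cycle through `av` when `c` is destroyed, replaces the lost edge, while destroying `v` no longer
cuts `a` off from `c` (`cost_swap_lt`). So in equilibrium all neighbors of `v` lie in one component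
of `G - v`. Then every edge at `v` is a non-bridge, and this spreads along walks to all vertices
(`exists_nonbridge_of_connected`), so there is no cutvertex. -/

/-- There is a walk from `x` to `y` in `G` that does not visit `u`. -/
def Avoids (G : SimpleGraph V) (u x y : V) : Prop :=
  ∃ p : G.Walk x y, u ∉ p.support

theorem Avoids.refl (h : u ≠ x) : Avoids G u x x :=
  ⟨.nil, by simpa using h⟩

theorem Avoids.symm (h : Avoids G u x y) : Avoids G u y x := by
  obtain ⟨p, hp⟩ := h
  exact ⟨p.reverse, by simpa using hp⟩

theorem Avoids.trans (h : Avoids G u x y) (h' : Avoids G u y z) : Avoids G u x z := by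
  obtain ⟨p, hp⟩ := h
  obtain ⟨q, hq⟩ := h'
  exact ⟨p.append q, by simp [SimpleGraph.Walk.mem_support_append_iff, hp, hq]⟩

theorem Avoids.of_adj (h : G.Adj x y) (hx : u ≠ x) (hy : u ≠ y) : Avoids G u x y :=
  ⟨h.toWalk, by simp [hx, hy]⟩

/-- Avoidance transfers from `G` to `H` as soon as it does so along the edges of `G`. -/
theorem Avoids.transfer
    (hGH : ∀ x y, G.Adj x y → u ≠ x → u ≠ y → Avoids H u x y) (h : Avoids G u x y) :
    Avoids H u x y := by
  obtain ⟨p, hp⟩ := h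
  induction p with
  | nil => exact .refl (by simpa using hp)
  | @cons x y z hxy p ih =>
    rw [SimpleGraph.Walk.support_cons, List.mem_cons, not_or] at hp
    exact (hGH x y hxy hp.1 fun h => hp.2 (h ▸ p.start_mem_support)).trans (ih hp.2)

theorem avoids_iff_exists_path : Avoids G u x y ↔ ∃ P : G.Path x y, u ∉ P.1.support := by
  classical
  refine ⟨fun ⟨p, hp⟩ => ⟨p.toPath, fun h => hp (p.support_toPath_subset_support h)⟩, ?_⟩
  rintro ⟨P, hP⟩
  exact ⟨P.1, hP⟩

theorem rel_eq (G : SimpleGraph V) (u v : V) :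
    rel G u v = {w : V | w ≠ v ∧ ¬ Avoids G u v w}.ncard := by
  simp [rel, avoids_iff_exists_path]

theorem Avoids.reachable_induce (h : Avoids G u x y) (hx : x ∈ ({u}ᶜ : Set V))
    (hy : y ∈ ({u}ᶜ : Set V)) : (G.induce {u}ᶜ).Reachable ⟨x, hx⟩ ⟨y, hy⟩ := by
  obtain ⟨p, hp⟩ := h
  exact ⟨p.induce {u}ᶜ fun z hz hzu => hp (by rwa [← Set.mem_singleton_iff.1 hzu])⟩

/-- In a connected graph every other vertex reaches a neighbor of `v` without visiting `v`. -/
theorem exists_adj_avoids {v : V} (hG : G.Connected) (hx : x ≠ v) :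
    ∃ c, G.Adj v c ∧ Avoids G v c x := by
  classical
  obtain ⟨p, hp⟩ := (hG.preconnected v x).exists_isPath
  cases p with
  | nil => exact absurd rfl hx
  | @cons _ c _ h p =>
    exact ⟨c, h, p, (SimpleGraph.Walk.cons_isPath_iff h p |>.1 hp).2⟩

theorem swap_adj {a b c : V} :
    (swap G a b c).Adj x y ↔
      (G.Adj x y ∧ s(x, y) ≠ s(a, b)) ∨ (SimpleGraph.edge a c).Adj x y := by
  simp [swap, removeEdge, SimpleGraph.deleteEdges_adj]

section Improvement

variable {a v c : V}

theorem swap_adj_new (hca : c ≠ a) : (swap G a v c).Adj a c :=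
  swap_adj.2 <| .inr <| by simp [SimpleGraph.edge_adj, hca.symm]

theorem swap_adj_old (hvc : G.Adj v c) (hca : c ≠ a) : (swap G a v c).Adj c v :=
  swap_adj.2 <| .inl ⟨hvc.symm, by
    have := hvc.ne
    simp only [ne_eq, Sym2.eq_iff]
    grind⟩

theorem swap_connected (hG : G.Connected) (hvc : G.Adj v c) (hca : c ≠ a) :
    (swap G a v c).Connected := by
  have hav : (swap G a v c).Reachable a v :=
    (swap_adj_new hca).reachable.trans (swap_adj_old hvc hca).reachable
  have key : ∀ x y, G.Walk x y → (swap G a v c).Reachable x y := by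
    intro x y p
    induction p with
    | nil => exact .rfl
    | @cons x y z h p ih =>
      refine .trans ?_ ih
      by_cases he : s(x, y) = s(a, v)
      · rcases Sym2.eq_iff.1 he with ⟨rfl, rfl⟩ | ⟨rfl, rfl⟩
        exacts [hav, hav.symm]
      · exact (swap_adj.2 (.inl ⟨h, he⟩)).reachable
  have := hG.nonempty
  exact ⟨fun x y => (hG.preconnected x y).elim (key x y)⟩

/-- If `v` separates `a` from `c`, then `av` being no bridge yields an `a`-`v` walk that uses
neither `av` nor `c`. -/
theorem avoids_removeEdge (hreach : (removeEdge G a v).Reachable a v) (hcv : c ≠ v)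
    (hsep : ¬ Avoids G v a c) : Avoids (removeEdge G a v) c a v := by
  classical
  obtain ⟨p, hp⟩ := hreach.exists_isPath
  have hle : removeEdge G a v ≤ G := SimpleGraph.deleteEdges_le _
  -- A path ending at `v` meets `v` only there, so its part up to `c` would contradict `hsep`.
  refine ⟨p, fun hc => hsep ⟨(p.takeUntil c hc).mapLe hle, ?_⟩⟩
  rw [SimpleGraph.Walk.support_mapLe_eq_support]
  exact SimpleGraph.Walk.endpoint_notMem_support_takeUntil hp hc hcv.symm

/-- Only the edge `av` is lost, so it suffices to bypass it while avoiding `u`: via `c` if `u ≠ c`,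
and along a cycle of `G` through `av` if `u = c`. -/
theorem Avoids.swap (hreach : (removeEdge G a v).Reachable a v) (hvc : G.Adj v c)
    (hca : c ≠ a) (hsep : ¬ Avoids G v a c) (h : Avoids G u x y) :
    Avoids (swap G a v c) u x y := by
  have hav : u ≠ a → u ≠ v → Avoids (SwapGame.swap G a v c) u a v := by
    intro hua huv
    by_cases huc : u = c
    · subst huc
      refine (avoids_removeEdge hreach hvc.ne' hsep).transfer fun x y hxy hx hy => ?_
      exact .of_adj (SimpleGraph.sup_adj _ _ _ _ |>.2 (.inl hxy)) hx hy
    · exact (of_adj (swap_adj_new hca) hua huc).trans (of_adj (swap_adj_old hvc hca) huc huv)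
  refine h.transfer fun x y hxy hx hy => ?_
  by_cases he : s(x, y) = s(a, v)
  · rcases Sym2.eq_iff.1 he with ⟨rfl, rfl⟩ | ⟨rfl, rfl⟩
    exacts [hav hx hy, (hav hy hx).symm]
  · exact .of_adj (swap_adj.2 (.inl ⟨hxy, he⟩)) hx hy

theorem cost_of_connected [Fintype V] {D : VertexDestroyer V} (hD : D.IsUniform)
    (hG : G.Connected) :
    cost D G v = ((∑ u : V, rel G u v : ℕ) : ℝ≥0∞) * (Fintype.card V : ℝ≥0∞)⁻¹ := by
  simp [cost, hG, hD G _, Finset.sum_mul]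

/-- No relevance for `a` grows, and that of `v` drops strictly, since `c` leaves the set of vertices
cut off. -/
theorem cost_swap_lt [Fintype V] {D : VertexDestroyer V} (hD : D.IsUniform) (hG : G.Connected)
    (hadj : G.Adj a v) (hreach : (removeEdge G a v).Reachable a v) (hvc : G.Adj v c)
    (hca : c ≠ a) (hsep : ¬ Avoids G v a c) : cost D (swap G a v c) a < cost D G a := by
  have hsub : ∀ u, {w : V | w ≠ a ∧ ¬ Avoids (swap G a v c) u a w} ⊆
      {w : V | w ≠ a ∧ ¬ Avoids G u a w} :=
    fun u w hw => ⟨hw.1, fun h => hw.2 (h.swap hreach hvc hca hsep)⟩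
  have hsum : ∑ u : V, rel (swap G a v c) u a < ∑ u : V, rel G u a := by
    simp only [rel_eq]
    refine Finset.sum_lt_sum (fun u _ => Set.ncard_le_ncard (hsub u)) ⟨v, Finset.mem_univ v, ?_⟩
    refine Set.ncard_lt_ncard ((Set.ssubset_iff_of_subset (hsub v)).2 ⟨c, ⟨hca, hsep⟩, ?_⟩)
    exact fun h => h.2 (.of_adj (swap_adj_new hca) hadj.ne' hvc.ne)
  have := hG.nonempty
  rw [cost_of_connected hD hG, cost_of_connected hD (swap_connected hG hvc hca)]
  exact ENNReal.mul_lt_mul_left (by simp) (by simp) (by exact_mod_cast hsum)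

end Improvement

/-- In a swap equilibrium, no endpoint of a non-bridge edge separates the other endpoint from a
further neighbor. -/
theorem IsSwapEquilibrium.avoids [Fintype V] {D : VertexDestroyer V} (hD : D.IsUniform)
    (hG : G.Connected) (hSE : IsSwapEquilibrium D G) {a v c : V} (hadj : G.Adj a v)
    (hreach : (removeEdge G a v).Reachable a v) (hvc : G.Adj v c) : Avoids G v a c := by
  by_contra hsep
  have hca : c ≠ a := by
    rintro rfl
    exact hsep (.refl hvc.ne)
  have hac : ¬ G.Adj a c := fun h => hsep (.of_adj h hadj.ne' hvc.ne)
  exact (hSE.1 a v c ⟨hadj, hca, hac⟩).not_gt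
    (cost_swap_lt hD hG hadj hreach hvc hca hsep)

theorem removeEdge_comm (G : SimpleGraph V) (a b : V) : removeEdge G a b = removeEdge G b a := by
  rw [removeEdge, removeEdge, Sym2.eq_swap]

/-- An edge `vc` such that `c` reaches another neighbor of `v` without visiting `v` is no bridge. -/
theorem Avoids.removeEdge_reachable {a v c : V} (hadj : G.Adj a v) (hca : c ≠ a)
    (h : Avoids G v a c) : (removeEdge G v c).Reachable v c := by
  have hva : (removeEdge G v c).Adj v a := by
    refine SimpleGraph.deleteEdges_adj.2 ⟨hadj.symm, ?_⟩
    have := hadj.ne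
    simp only [Set.mem_singleton_iff, Sym2.eq_iff]
    grind
  obtain ⟨p, -⟩ : Avoids (removeEdge G v c) v a c := by
    -- A walk avoiding `v` cannot use the deleted edge `vc`.
    refine h.transfer fun x y hxy hx hy => .of_adj ?_ hx hy
    refine SimpleGraph.deleteEdges_adj.2 ⟨hxy, ?_⟩
    simp only [Set.mem_singleton_iff, Sym2.eq_iff]
    grind
  exact hva.reachable.trans p.reachable

/-- If no endpoint of a non-bridge edge separates the other endpoint from a further neighbor, then
every vertex is incident to a non-bridge edge as soon as one is. -/
theorem exists_nonbridge_of_connected (hG : G.Connected)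
    (h : ∀ a v c, G.Adj a v → (removeEdge G a v).Reachable a v → G.Adj v c → Avoids G v a c)
    {a v : V} (hadj : G.Adj a v) (hreach : (removeEdge G a v).Reachable a v) (w : V) :
    ∃ b, G.Adj b w ∧ (removeEdge G b w).Reachable b w := by
  obtain ⟨p⟩ := hG.preconnected v w
  induction p generalizing a with
  | nil => exact ⟨a, hadj, hreach⟩
  | @cons v c w hvc p ih =>
    by_cases hca : c = a
    · subst hca
      exact ih hvc (by rw [removeEdge_comm]; exact hreach.symm)
    · exact ih hvc ((h a v c hadj hreach hvc).removeEdge_reachable hadj hca)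

theorem isBlock_iff_of_isTwoConnected [Fintype V] (h : IsTwoConnected G) (B : Set V) :
    IsBlock G B ↔ B = Set.univ := by
  have huniv : IsNonseparable G Set.univ := by
    refine ⟨(SimpleGraph.induceUnivIso G).connected_iff.2 h.2.1, fun v _ => ?_⟩
    rw [← Set.compl_eq_univ_sdiff]
    exact (h.2.2 v).preconnected
  constructor
  · exact fun hB => Set.eq_univ_of_univ_subset (hB.2 huniv (Set.subset_univ B))
  · rintro rfl
    exact ⟨huniv, fun _ _ _ => Set.subset_univ _⟩

end

end SwapGame

theorem mainTheorem4 (n : ℕ) (hn : 3 ≤ n)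
    (D : SwapGame.VertexDestroyer (Fin n)) (hD : D.IsUniform)
    (G : SimpleGraph (Fin n)) (hG : G.Connected)
    (hSE : SwapGame.IsSwapEquilibrium D G) :
    (SwapGame.IsTwoConnected G ∧ ∃! B : Set (Fin n), SwapGame.IsBlock G B) ∨ G.IsTree := by
  by_cases hac : G.IsAcyclic
  · exact .inr ⟨hG, hac⟩
  refine .inl ?_
  have hav : ∃ a v, G.Adj a v ∧ (SwapGame.removeEdge G a v).Reachable a v := by
    by_contra! hcon
    refine hac (SimpleGraph.isAcyclic_iff_forall_adj_isBridge.2 fun a v hadj => ?_)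
    exact SimpleGraph.isBridge_iff.2 (hcon a v hadj)
  obtain ⟨a, v, hadj, hreach⟩ := hav
  have hav := fun a v c => hSE.avoids (a := a) (v := v) (c := c) hD hG
  have htwo : SwapGame.IsTwoConnected G := by
    refine ⟨by simpa using hn, hG, fun v => ?_⟩
    obtain ⟨b, hb, hbr⟩ := SwapGame.exists_nonbridge_of_connected hG hav hadj hreach v
    -- Each component of `G - v` contains a neighbor of `v`, and all of these are joined to `b`.
    have key : ∀ x, x ≠ v → SwapGame.Avoids G v b x := fun x hx => by
      obtain ⟨c, hc, hcx⟩ := SwapGame.exists_adj_avoids hG hx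
      exact (hav b v c hb hbr hc).trans hcx
    have : Nonempty ({v}ᶜ : Set (Fin n)) := ⟨⟨b, hb.ne⟩⟩
    exact ⟨fun x y => ((key x x.2).symm.trans (key y y.2)).reachable_induce x.2 y.2⟩
  exact ⟨htwo, Set.univ, (SwapGame.isBlock_iff_of_isTwoConnected htwo _).2 rfl,
    fun B hB => (SwapGame.isBlock_iff_of_isTwoConnected htwo B).1 hB⟩
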